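/- Let $n,L,N\ge 1$ be integers, $\sigma>0$, $A=\{1,\dots,L+1\}$, and let $\pi_0$ be a probability distribution on $A^n$ with $\pi_0(z)>0$ for all $z\in A^n$. Let $D\subset\mathbb{R}^{nL}$ be bounded and $\theta=(\theta_{ta})_{t\le n,\,a\le L}\in D$. Let $(\omega_i,Y_i)$, $i=1,\dots,N$, be i.i.d. random vectors with values in $A^n\times\mathbb{R}^n$, such that $\omega_i=(\omega_{i1},\dots,\omega_{in})$ has the exponentially tilted law $$\pi(z\mid\theta)\propto \pi_0(z)\exp\Big\{\sum_{t=1}^n\sum_{a=1}^L \mathbf 1\{z_t=a\}\,\theta_{ta}\Big\},\qquad z\in A^n,$$ and, conditionally on $\omega_i$, the coordinates $Y_{i1},\dots,Y_{in}$ of $Y_i$ are independent with $Y_{it}\sim N(\omega_{it},\sigma^2)$. For $z\in A^n$ let $x(z)\in\{0,1\}^{nL}$ be the vector with $(t,a)$-th entry $\mathbf 1\{z_t=a\}$ ($t\le n$, $a\le L$), and for $y\in\mathbb{R}^n$ let $k(z,y)=\prod_{t=1}^n f((z_t-y_t)/\sigma)$ with $f$ the density of $N(0,1)$. For $u\in\mathbb{R}^{nL}$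 let $$\ell(u)=-\sum_{i=1}^N\ln\Big(\sum_{z\in A^n}e^{x(z)^{\top}u}\,k(z,Y_i)\,\pi_0(z)\Big)+N\ln Z(u),\qquad Z(u)=\sum_{z\in A^n}\pi_0(z)\int_{\mathbb{R}^n}e^{x(z)^{\top}u}\,k(z,y)\,dy,$$ be the negative log-likelihood of the observations $Y_1,\dots,Y_N$. Then $\ell(u)$ is integrable for every $u\in D$, and there is a constant $C>0$ such that $$\mathbb{E}\,\ell(u)-\mathbb{E}\,\ell(\theta)\ \ge\ C\,\|u-\theta\|_2^2\qquad\text{for all } u\in D.$$ -/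

import Mathlib

open MeasureTheory ProbabilityTheory

namespace HiddenVar

noncomputable section

/-! Hidden variable model: the pair `(ω, Y)` has density
`g (x z ⬝ θ) * k z y / Z θ` with respect to `μ ⊗ ν`. -/

/-- The normalizing constant `Z(u) = ∫ g(x(z)ᵀ u) k(z, y) μ(dz) ν(dy)`. -/
def normalizer {Z 𝓨 ι : Type*} [MeasurableSpace Z] [MeasurableSpace 𝓨] [Fintype ι]
    (g : ℝ → ℝ) (x : Z → EuclideanSpace ℝ ι) (k : Z → 𝓨 → ℝ) (μ : Measure Z) (ν : Measure 𝓨)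
    (u : EuclideanSpace ℝ ι) : ℝ :=
  ∫ p, g (inner ℝ (x p.1) u) * k p.1 p.2 ∂(μ.prod ν)

/-- The (negative) log-likelihood
`ℓ(u, y₁, …, y_N) = - ∑ᵢ ln ∫ gᵢ(xᵢ(z)ᵀ u) kᵢ(z, yᵢ) μᵢ(dz) + ∑ᵢ ln Zᵢ(u)`. -/
def negLogLik {Z 𝓨 ι : Type*} [MeasurableSpace Z] [MeasurableSpace 𝓨] [Fintype ι] {N : ℕ}
    (g : Fin N → ℝ → ℝ) (x : Fin N → Z → EuclideanSpace ℝ ι) (k : Fin N → Z → 𝓨 → ℝ)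
    (μ : Fin N → Measure Z) (ν : Fin N → Measure 𝓨)
    (u : EuclideanSpace ℝ ι) (y : Fin N → 𝓨) : ℝ :=
  -∑ i, Real.log (∫ z, g i (inner ℝ (x i z) u) * k i z (y i) ∂(μ i)) +
    ∑ i, Real.log (normalizer (g i) (x i) (k i) (μ i) (ν i) u)

/-! Finite-alphabet hidden process of length `n` over the alphabet `{1, …, L + 1}`, with Gaussian
observations.  The letter `a ∈ {1, …, L + 1}` is represented by `a - 1 : Fin (L + 1)`, and the
coordinates of the parameter by pairs `(t, a) : Fin n × Fin L`. -/

/-- Hidden sequences, the set `Aⁿ`. -/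
abbrev Word (n L : ℕ) : Type := Fin n → Fin (L + 1)

/-- The parameter space `ℝ^{nL}` with the Euclidean norm. -/
abbrev Param (n L : ℕ) : Type := EuclideanSpace ℝ (Fin n × Fin L)

/-- The numerical value in `{1, …, L + 1}` of a letter. -/
def letterVal {L : ℕ} (a : Fin (L + 1)) : ℝ := (a : ℕ) + 1

/-- `x(z) ∈ {0,1}^{nL}`, with `(t, a)` entry equal to `1{z_t = a}`; the last letter `L + 1` has no
coordinate. -/
def feature {n L : ℕ} (z : Word n L) : Param n L :=
  WithLp.toLp 2 fun ta => if z ta.1 = ta.2.castSucc then 1 else 0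

/-- `k(z, y) = ∏_{t ≤ n} f((z_t - y_t) / σ)`, with `f` the density of `N(0,1)`. -/
def emission {n L : ℕ} (σ : ℝ) (z : Word n L) (y : Fin n → ℝ) : ℝ :=
  ∏ t, gaussianPDFReal 0 1 ((letterVal (z t) - y t) / σ)

/-- `π(z | θ) ∝ π₀(z) exp (∑_{t ≤ n} ∑_{a ≤ L} 1{z_t = a} θ_{ta})`. -/
def hiddenLaw {n L : ℕ} (π₀ : Measure (Word n L)) (θ : Param n L) : Measure (Word n L) :=
  π₀.tilted fun z => ∑ t : Fin n, ∑ a : Fin L, if z t = a.castSucc then θ (t, a) else 0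

/-- Conditional law of the observations given the hidden sequence `z`: the coordinates are
independent, the `t`-th one being `N(z_t, σ²)`. -/
def obsKernel (n L : ℕ) (σ : ℝ) : Kernel (Word n L) (Fin n → ℝ) :=
  Kernel.ofFunOfCountable fun z =>
    Measure.pi fun t => gaussianReal (letterVal (z t)) (Real.toNNReal (σ ^ 2))

instance isMarkovKernel_obsKernel (n L : ℕ) (σ : ℝ) : IsMarkovKernel (obsKernel n L σ) :=
  ⟨fun z => by
    change IsProbabilityMeasure
      (Measure.pi fun t => gaussianReal (letterVal (z t)) (Real.toNNReal (σ ^ 2)))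
    infer_instance⟩

/-- Joint law of a hidden sequence and its observations. -/
def jointLaw {n L : ℕ} (π₀ : Measure (Word n L)) (σ : ℝ) (θ : Param n L) :
    Measure (Word n L × (Fin n → ℝ)) :=
  (hiddenLaw π₀ θ).compProd (obsKernel n L σ)

/-- The negative log-likelihood of `N` observed sequences: `gᵢ = exp`, `xᵢ = feature`,
`kᵢ = emission σ`, `μᵢ = π₀` and `νᵢ` is Lebesgue measure. -/
def hmmNegLogLik {n L N : ℕ} (π₀ : Measure (Word n L)) (σ : ℝ)
    (u : Param n L) (y : Fin N → Fin n → ℝ) : ℝ :=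
  negLogLik (fun _ => Real.exp) (fun _ => feature) (fun _ => emission σ) (fun _ => π₀)
    (fun _ => (volume : Measure (Fin n → ℝ))) u y

end

end HiddenVar

namespace HiddenVar

open scoped NNReal ENNReal

/-! ### A quadratic lower bound for the Kullback–Leibler integrand -/

/-! Up to constants that cancel, `ℓ(u)` is the sum of `-log p_u(Y_i)`, where `p_u = ∑ z, π(z|u) φ_z`
is a mixture of Gaussian product densities (`hmmNegLogLik_eq`). The expected excess is therefore `N`
times the Kullback–Leibler divergence of `p_θ` from `p_u`, and three quadratic bounds are chained.
The densities are bounded by some `K`, so the divergence dominates `‖p_u - p_θ‖² / (4K)` in `L²`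
(`mul_norm_sq_le_integral_mul_log`). The `φ_z` are linearly independent, so this `L²` norm controls
the sup norm of the difference of the weights (`exists_pos_mul_norm_sq_le_integral_wordDensity`). On
a bounded set the weights stay away from `0`, so their logarithms are controlled, and log-odds
against the all-last-letter word give back the parameter (`abs_sub_le_norm_tiltWeight_sub`). -/

theorem sq_sub_div_le_mul_log_sub {p q K : ℝ} (hp : 0 < p) (hq : 0 < q) (hpK : p ≤ K)
    (hqK : q ≤ K) : (q - p) ^ 2 / (4 * K) ≤ p * (Real.log p - Real.log q) - p + q := by
  -- With `p = a²` and `q = b²`, the bound `log (b/a) ≤ b/a - 1` makes the right side at least the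
  -- Hellinger integrand `(b - a)²`; then `(b² - a²)² = (b - a)² (b + a)²` with `(b + a)² ≤ 4K`.
  obtain ⟨a, ha, rfl⟩ : ∃ a, 0 < a ∧ p = a ^ 2 :=
    ⟨√p, Real.sqrt_pos.2 hp, (Real.sq_sqrt hp.le).symm⟩
  obtain ⟨b, hb, rfl⟩ : ∃ b, 0 < b ∧ q = b ^ 2 :=
    ⟨√q, Real.sqrt_pos.2 hq, (Real.sq_sqrt hq.le).symm⟩
  have hlog : Real.log b - Real.log a ≤ b / a - 1 := by
    rw [← Real.log_div hb.ne' ha.ne']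
    exact Real.log_le_sub_one_of_pos (div_pos hb ha)
  have h1 : a ^ 2 * (Real.log b - Real.log a) ≤ a * b - a ^ 2 := by
    calc a ^ 2 * (Real.log b - Real.log a) ≤ a ^ 2 * (b / a - 1) := by gcongr
      _ = a * b - a ^ 2 := by field_simp
  have h2 : (b ^ 2 - a ^ 2) ^ 2 / (4 * K) ≤ (b - a) ^ 2 := by
    rw [div_le_iff₀ (by linarith [sq_nonneg a])]
    have h3 : (b + a) ^ 2 ≤ 4 * K := by nlinarith [sq_nonneg (b - a)]
    calc (b ^ 2 - a ^ 2) ^ 2 = (b - a) ^ 2 * (b + a) ^ 2 := by ring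
      _ ≤ (b - a) ^ 2 * (4 * K) := by gcongr
  simp only [Real.log_pow, Nat.cast_ofNat]
  nlinarith

theorem abs_log_sub_log_le {a b m : ℝ} (hm : 0 < m) (ha : m ≤ a) (hb : m ≤ b) :
    |Real.log a - Real.log b| ≤ |a - b| / m := by
  have key : ∀ {a b : ℝ}, m ≤ a → m ≤ b → Real.log a - Real.log b ≤ |a - b| / m := by
    intro a b ha hb
    have hb' := hm.trans_le hb
    have ha' := hm.trans_le ha
    calc Real.log a - Real.log b = Real.log (a / b) := (Real.log_div ha'.ne' hb'.ne').symm
      _ ≤ a / b - 1 := Real.log_le_sub_one_of_pos (div_pos ha' hb')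
      _ = (a - b) / b := by field_simp
      _ ≤ |a - b| / b := by gcongr; exact le_abs_self _
      _ ≤ |a - b| / m := by gcongr
  refine abs_le.2 ⟨?_, key ha hb⟩
  have := key hb ha
  rw [abs_sub_comm] at this
  linarith

/-! ### Coercivity of the Gram form of a finite linearly independent family in `L²` -/

/-- The integral is a continuous quadratic form in `w`, positive off `0`; its minimum over the
compact unit sphere of the sup norm serves as `c`, by homogeneity. -/
theorem exists_pos_mul_norm_sq_le_integral_sq {Z E : Type*} [Fintype Z] [MeasurableSpace E]
    {ν : Measure E} (φ : Z → E → ℝ)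
    (hint : ∀ z z', Integrable (fun y => φ z y * φ z' y) ν)
    (hli : ∀ w : Z → ℝ, ∫ y, (∑ z, w z * φ z y) ^ 2 ∂ν = 0 → w = 0) :
    ∃ c : ℝ, 0 < c ∧ ∀ w : Z → ℝ, c * ‖w‖ ^ 2 ≤ ∫ y, (∑ z, w z * φ z y) ^ 2 ∂ν := by
  -- For empty `Z` the unit sphere is empty and there is no minimizer.
  rcases isEmpty_or_nonempty Z with hZ | hZ
  · refine ⟨1, one_pos, fun w => ?_⟩
    simp [Subsingleton.elim w 0]
  set Q : (Z → ℝ) → ℝ := fun w => ∫ y, (∑ z, w z * φ z y) ^ 2 ∂ν with hQ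
  have hQsum : ∀ w, Q w = ∑ z, ∑ z', w z * w z' * ∫ y, φ z y * φ z' y ∂ν := by
    intro w
    have hI : ∀ z z', Integrable (fun y => w z * φ z y * (w z' * φ z' y)) ν := fun z z' =>
      ((hint z z').const_mul (w z * w z')).congr (.of_forall fun y => by simp only []; ring)
    simp only [hQ, sq, Finset.sum_mul_sum]
    rw [integral_finsetSum _ fun z _ => integrable_finsetSum _ fun z' _ => hI z z']
    refine Finset.sum_congr rfl fun z _ => ?_
    rw [integral_finsetSum _ fun z' _ => hI z z']
    refine Finset.sum_congr rfl fun z' _ => ?_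
    rw [← integral_const_mul]
    congr 1 with y
    ring
  have hcont : Continuous Q := by
    rw [funext hQsum]
    fun_prop
  obtain ⟨w₀, hw₀, hmin⟩ := (isCompact_sphere (0 : Z → ℝ) 1).exists_isMinOn
    (NormedSpace.sphere_nonempty.2 zero_le_one) hcont.continuousOn
  have hpos : 0 < Q w₀ := by
    refine lt_of_le_of_ne (integral_nonneg fun y => sq_nonneg _) fun h => ?_
    have := hli w₀ h.symm
    simp [this] at hw₀
  refine ⟨Q w₀, hpos, fun w => ?_⟩
  rcases eq_or_ne w 0 with rfl | hw
  · simp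
  have hn : ‖w‖ ≠ 0 := norm_ne_zero_iff.2 hw
  have h1 : Q w₀ ≤ Q (‖w‖⁻¹ • w) := hmin (by simp [norm_smul, hn])
  have h2 : Q (‖w‖⁻¹ • w) = (‖w‖ ^ 2)⁻¹ * Q w := by
    simp only [hQ]
    rw [← integral_const_mul]
    congr 1 with y
    simp only [Pi.smul_apply, smul_eq_mul, mul_assoc, ← Finset.mul_sum]
    ring
  rw [h2, inv_mul_eq_div, le_div_iff₀ (by positivity)] at h1
  exact h1

/-! ### Kullback–Leibler divergence between mixtures of a bounded family of densities -/

/-- The pointwise bound is integrated; its correction `-p + q` contributes nothing because both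
mixtures have total mass one. Convexity carries the bound `K` from the components to the mixtures.
-/
theorem mul_norm_sq_le_integral_mul_log {Z E : Type*} [Fintype Z] [MeasurableSpace E]
    {ν : Measure E} {φ : Z → E → ℝ} {K c : ℝ} (hφ : ∀ z y, 0 < φ z y) (hφK : ∀ z y, φ z y ≤ K)
    (hφi : ∀ z, Integrable (φ z) ν) (hφ1 : ∀ z, ∫ y, φ z y ∂ν = 1) (hK : 0 < K)
    (hint : ∀ z z', Integrable (fun y => φ z y * φ z' y) ν)
    (hc : ∀ w : Z → ℝ, c * ‖w‖ ^ 2 ≤ ∫ y, (∑ z, w z * φ z y) ^ 2 ∂ν)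
    {p q : Z → ℝ} (hp : ∀ z, 0 < p z) (hq : ∀ z, 0 < q z) (hp1 : ∑ z, p z = 1)
    (hq1 : ∑ z, q z = 1)
    (hlog : Integrable (fun y => (∑ z, p z * φ z y) *
      (Real.log (∑ z, p z * φ z y) - Real.log (∑ z, q z * φ z y))) ν) :
    c / (4 * K) * ‖q - p‖ ^ 2 ≤ ∫ y, (∑ z, p z * φ z y) *
      (Real.log (∑ z, p z * φ z y) - Real.log (∑ z, q z * φ z y)) ∂ν := by
  have hne : (Finset.univ : Finset Z).Nonempty := by
    by_contra h
    simp [Finset.not_nonempty_iff_eq_empty.1 h] at hp1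
  have hpos : ∀ {r : Z → ℝ}, (∀ z, 0 < r z) → ∀ y, 0 < ∑ z, r z * φ z y := fun hr y =>
    Finset.sum_pos (fun z _ => mul_pos (hr z) (hφ z y)) hne
  have hle : ∀ {r : Z → ℝ}, (∀ z, 0 < r z) → ∑ z, r z = 1 → ∀ y, ∑ z, r z * φ z y ≤ K := by
    intro r hr hr1 y
    calc ∑ z, r z * φ z y ≤ ∑ z, r z * K :=
          Finset.sum_le_sum fun z _ => mul_le_mul_of_nonneg_left (hφK z y) (hr z).le
      _ = K := by rw [← Finset.sum_mul, hr1, one_mul]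
  have hinteg : ∀ r : Z → ℝ, Integrable (fun y => ∑ z, r z * φ z y) ν := fun r =>
    integrable_finsetSum _ fun z _ => (hφi z).const_mul _
  have hone : ∀ {r : Z → ℝ}, ∑ z, r z = 1 → ∫ y, ∑ z, r z * φ z y ∂ν = 1 := by
    intro r hr1
    rw [integral_finsetSum _ fun z _ => (hφi z).const_mul _]
    simp [integral_const_mul, hφ1, hr1]
  have hsq : Integrable (fun y => (∑ z, (q - p) z * φ z y) ^ 2) ν := by
    simp only [sq, Finset.sum_mul_sum]
    refine integrable_finsetSum _ fun z _ => integrable_finsetSum _ fun z' _ => ?_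
    exact ((hint z z').const_mul ((q - p) z * (q - p) z')).congr
      (.of_forall fun y => by simp only []; ring)
  have hdiff : ∀ y, ∑ z, (q - p) z * φ z y = ∑ z, q z * φ z y - ∑ z, p z * φ z y := by
    intro y
    simp [sub_mul, Finset.sum_sub_distrib]
  calc c / (4 * K) * ‖q - p‖ ^ 2 = c * ‖q - p‖ ^ 2 / (4 * K) := by ring
    _ ≤ (∫ y, (∑ z, (q - p) z * φ z y) ^ 2 ∂ν) / (4 * K) := by gcongr; exact hc _
    _ = ∫ y, (∑ z, (q - p) z * φ z y) ^ 2 / (4 * K) ∂ν := (integral_div _ _).symm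
    _ ≤ ∫ y, ((∑ z, p z * φ z y) *
          (Real.log (∑ z, p z * φ z y) - Real.log (∑ z, q z * φ z y)) -
          (∑ z, p z * φ z y) + ∑ z, q z * φ z y) ∂ν := by
        refine integral_mono (hsq.div_const _) ((hlog.sub (hinteg p)).add (hinteg q)) fun y => ?_
        simp only [hdiff]
        exact sq_sub_div_le_mul_log_sub (hpos hp y) (hpos hq y) (hle hp hp1 y) (hle hq hq1 y)
    _ = _ := by
        refine (integral_add (hlog.sub (hinteg p)) (hinteg q)).trans ?_
        rw [integral_sub' hlog (hinteg p), hone hp1, hone hq1]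
        ring

variable {n L : ℕ}

/-! ### The tilted law of the hidden word -/

/-- The mass `π(z | u)` of the word `z` under the tilted law. -/
noncomputable def tiltWeight (π₀ : Measure (Word n L)) (u : Param n L) (z : Word n L) : ℝ :=
  π₀.real {z} * Real.exp (inner ℝ (feature z) u) /
    ∑ z', π₀.real {z'} * Real.exp (inner ℝ (feature z') u)

theorem inner_feature (z : Word n L) (u : Param n L) :
    inner ℝ (feature z) u = ∑ t, ∑ a, if z t = a.castSucc then u (t, a) else 0 := by
  simp [feature, PiLp.inner_apply, Fintype.sum_prod_type]

section

variable {π₀ : Measure (Word n L)} [IsProbabilityMeasure π₀]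

theorem measureReal_singleton_pos (hπ₀ : ∀ z : Word n L, 0 < π₀ {z}) (z : Word n L) :
    0 < π₀.real {z} :=
  ENNReal.toReal_pos (hπ₀ z).ne' (measure_ne_top _ _)

theorem sum_measureReal_mul_exp_pos (hπ₀ : ∀ z : Word n L, 0 < π₀ {z}) (u : Param n L) :
    0 < ∑ z, π₀.real {z} * Real.exp (inner ℝ (feature z) u) :=
  Finset.sum_pos (fun z _ => mul_pos (measureReal_singleton_pos hπ₀ z) (Real.exp_pos _))
    Finset.univ_nonempty

theorem tiltWeight_pos (hπ₀ : ∀ z : Word n L, 0 < π₀ {z}) (u : Param n L) (z : Word n L) :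
    0 < tiltWeight π₀ u z :=
  div_pos (mul_pos (measureReal_singleton_pos hπ₀ z) (Real.exp_pos _))
    (sum_measureReal_mul_exp_pos hπ₀ u)

theorem sum_tiltWeight (hπ₀ : ∀ z : Word n L, 0 < π₀ {z}) (u : Param n L) :
    ∑ z, tiltWeight π₀ u z = 1 := by
  simp only [tiltWeight, ← Finset.sum_div]
  exact div_self (sum_measureReal_mul_exp_pos hπ₀ u).ne'

theorem hiddenLaw_real_singleton (θ : Param n L) (z : Word n L) :
    (hiddenLaw π₀ θ).real {z} = tiltWeight π₀ θ z := by
  simp only [hiddenLaw, ← inner_feature]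
  rw [measureReal_def, tilted_apply_eq_ofReal_integral' _ (MeasurableSet.singleton z),
    ENNReal.toReal_ofReal (integral_nonneg fun _ => by positivity), integral_singleton,
    integral_fintype Integrable.of_finite, smul_eq_mul]
  simp only [smul_eq_mul, tiltWeight, mul_div_assoc]

instance isProbabilityMeasure_hiddenLaw (θ : Param n L) :
    IsProbabilityMeasure (hiddenLaw π₀ θ) :=
  isProbabilityMeasure_tilted Integrable.of_finite

/-- Each weight is continuous and positive on a compact ball containing `D`, and there are finitely
many words. -/
theorem exists_le_tiltWeight (hπ₀ : ∀ z : Word n L, 0 < π₀ {z}) {D : Set (Param n L)}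
    (hD : Bornology.IsBounded D) :
    ∃ m : ℝ, 0 < m ∧ ∀ u ∈ D, ∀ z, m ≤ tiltWeight π₀ u z := by
  obtain ⟨R, hR⟩ := hD.subset_closedBall 0
  have hcont : ∀ z, Continuous fun u => tiltWeight π₀ u z := fun z =>
    Continuous.div (by fun_prop) (by fun_prop) fun u => (sum_measureReal_mul_exp_pos hπ₀ u).ne'
  have hz : ∀ z, ∃ m : ℝ, 0 < m ∧ ∀ u ∈ Metric.closedBall (0 : Param n L) R,
      m ≤ tiltWeight π₀ u z := fun z =>
    (isCompact_closedBall _ _).exists_forall_le' (hcont z).continuousOn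
      fun u _ => tiltWeight_pos hπ₀ u z
  choose m hm hle using hz
  obtain ⟨z₀, hz₀⟩ := Finite.exists_min m
  exact ⟨m z₀, hm z₀, fun u hu z => (hz₀ z).trans (hle z u (hR hu))⟩

theorem log_tiltWeight (hπ₀ : ∀ z : Word n L, 0 < π₀ {z}) (u : Param n L) (z : Word n L) :
    Real.log (tiltWeight π₀ u z) = Real.log (π₀.real {z}) + inner ℝ (feature z) u -
      Real.log (∑ z', π₀.real {z'} * Real.exp (inner ℝ (feature z') u)) := by
  have h := measureReal_singleton_pos hπ₀ z
  rw [tiltWeight, Real.log_div (mul_pos h (Real.exp_pos _)).ne'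
    (sum_measureReal_mul_exp_pos hπ₀ u).ne', Real.log_mul h.ne' (Real.exp_pos _).ne',
    Real.log_exp]

/-- The word with letter `a` at position `t`, all other letters being the last one. -/
def singleLetterWord (t : Fin n) (a : Fin L) : Word n L :=
  Function.update (fun _ => Fin.last L) t a.castSucc

theorem inner_feature_last (u : Param n L) :
    inner ℝ (feature fun _ => Fin.last L) u = 0 := by
  rw [inner_feature]
  refine Finset.sum_eq_zero fun t _ => Finset.sum_eq_zero fun a _ => if_neg ?_
  exact (Fin.castSucc_lt_last a).ne'

theorem inner_feature_singleLetterWord (t : Fin n) (a : Fin L) (u : Param n L) :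
    inner ℝ (feature (singleLetterWord t a)) u = u (t, a) := by
  rw [inner_feature, Finset.sum_eq_single t]
  · simp [singleLetterWord, Fin.castSucc_inj]
  · intro s _ hs
    refine Finset.sum_eq_zero fun b _ => if_neg ?_
    simpa [singleLetterWord, hs] using (Fin.castSucc_lt_last b).ne'
  · simp

/-- In the log-odds of `singleLetterWord t a` against the all-last-letter word the normalizers
cancel, leaving `u (t, a)` plus a term independent of `u`. Each of the two logarithms moves by at
most the norm over `m`, whence `2 / m`. -/
theorem abs_sub_le_norm_tiltWeight_sub (hπ₀ : ∀ z : Word n L, 0 < π₀ {z}) {m : ℝ} (hm : 0 < m)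
    {u θ : Param n L} (hu : ∀ z, m ≤ tiltWeight π₀ u z) (hθ : ∀ z, m ≤ tiltWeight π₀ θ z)
    (t : Fin n) (a : Fin L) :
    |u (t, a) - θ (t, a)| ≤ 2 / m * ‖tiltWeight π₀ u - tiltWeight π₀ θ‖ := by
  have key : ∀ z, |Real.log (tiltWeight π₀ u z) - Real.log (tiltWeight π₀ θ z)| ≤
      ‖tiltWeight π₀ u - tiltWeight π₀ θ‖ / m := fun z =>
    (abs_log_sub_log_le hm (hu z) (hθ z)).trans <| by
      gcongr
      exact norm_le_pi_norm (tiltWeight π₀ u - tiltWeight π₀ θ) z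
  have h1 := key (singleLetterWord t a)
  have h2 := key fun _ => Fin.last L
  simp only [log_tiltWeight hπ₀, inner_feature_last, inner_feature_singleLetterWord] at h1 h2
  rw [abs_le] at *
  have e : 2 / m * ‖tiltWeight π₀ u - tiltWeight π₀ θ‖ =
      2 * (‖tiltWeight π₀ u - tiltWeight π₀ θ‖ / m) := by ring
  rw [e]
  constructor <;> linarith [h1.1, h1.2, h2.1, h2.2]

/-- Identifiability of the tilted laws, with a quadratic rate. -/
theorem exists_mul_norm_sub_sq_le_norm_tiltWeight_sub (hπ₀ : ∀ z : Word n L, 0 < π₀ {z})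
    {D : Set (Param n L)} (hD : Bornology.IsBounded D) :
    ∃ c : ℝ, 0 < c ∧ ∀ u ∈ D, ∀ θ ∈ D,
      c * ‖u - θ‖ ^ 2 ≤ ‖tiltWeight π₀ u - tiltWeight π₀ θ‖ ^ 2 := by
  obtain ⟨m, hm, hle⟩ := exists_le_tiltWeight hπ₀ hD
  set B : ℝ := (Fintype.card (Fin n × Fin L) : ℝ) * (2 / m) ^ 2 with hB
  have hB0 : 0 ≤ B := by positivity
  -- The `+ 1` keeps the constant positive when there are no coordinates and `B = 0`.
  refine ⟨(B + 1)⁻¹, by positivity, fun u hu θ hθ => ?_⟩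
  rw [inv_mul_le_iff₀ (by positivity)]
  have h : ‖u - θ‖ ^ 2 ≤ B * ‖tiltWeight π₀ u - tiltWeight π₀ θ‖ ^ 2 := by
    rw [EuclideanSpace.norm_sq_eq]
    calc ∑ i, ‖(u - θ) i‖ ^ 2
        ≤ ∑ _i : Fin n × Fin L, (2 / m * ‖tiltWeight π₀ u - tiltWeight π₀ θ‖) ^ 2 := by
          refine Finset.sum_le_sum fun i _ => ?_
          gcongr
          exact abs_sub_le_norm_tiltWeight_sub hπ₀ hm (hle u hu) (hle θ hθ) i.1 i.2
      _ = B * ‖tiltWeight π₀ u - tiltWeight π₀ θ‖ ^ 2 := by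
          rw [Finset.sum_const, Finset.card_univ, nsmul_eq_mul, hB]
          ring
  nlinarith [sq_nonneg ‖tiltWeight π₀ u - tiltWeight π₀ θ‖]

end

/-! ### The Gaussian density of the observations given the hidden word -/

/-- The density of `N(z₁, v) ⊗ ⋯ ⊗ N(zₙ, v)`. -/
noncomputable def wordDensity (v : ℝ≥0) (z : Word n L) (y : Fin n → ℝ) : ℝ :=
  ∏ t, gaussianPDFReal (letterVal (z t)) v (y t)

theorem wordDensity_pos {v : ℝ≥0} (hv : v ≠ 0) (z : Word n L) (y : Fin n → ℝ) :
    0 < wordDensity v z y :=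
  Finset.prod_pos fun _ _ => gaussianPDFReal_pos _ _ _ hv

theorem wordDensity_nonneg (v : ℝ≥0) (z : Word n L) (y : Fin n → ℝ) : 0 ≤ wordDensity v z y :=
  Finset.prod_nonneg fun _ _ => gaussianPDFReal_nonneg _ _ _

theorem continuous_wordDensity (v : ℝ≥0) (z : Word n L) : Continuous (wordDensity v z) := by
  unfold wordDensity
  simp only [gaussianPDFReal]
  fun_prop

theorem wordDensity_le (v : ℝ≥0) (z : Word n L) (y : Fin n → ℝ) :
    wordDensity v z y ≤ (√(2 * Real.pi * v))⁻¹ ^ n := by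
  calc wordDensity v z y ≤ ∏ _t : Fin n, (√(2 * Real.pi * v))⁻¹ := by
        refine Finset.prod_le_prod (fun _ _ => gaussianPDFReal_nonneg _ _ _) fun t _ => ?_
        rw [gaussianPDFReal]
        refine mul_le_of_le_one_right (by positivity) (Real.exp_le_one_iff.2 ?_)
        rw [neg_div]
        exact neg_nonpos.2 (by positivity)
    _ = _ := by simp

theorem integrable_wordDensity (v : ℝ≥0) (z : Word n L) : Integrable (wordDensity v z) :=
  Integrable.fintype_prod fun t => integrable_gaussianPDFReal (letterVal (z t)) v

theorem integral_wordDensity {v : ℝ≥0} (hv : v ≠ 0) (z : Word n L) :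
    ∫ y, wordDensity v z y = 1 := by
  unfold wordDensity
  rw [integral_fintype_prod_volume_eq_prod]
  simp [integral_gaussianPDFReal_eq_one _ hv]

theorem integrable_wordDensity_mul (v : ℝ≥0) (z z' : Word n L) :
    Integrable fun y => wordDensity v z y * wordDensity v z' y := by
  refine (integrable_wordDensity v z').bdd_mul (c := (√(2 * Real.pi * v))⁻¹ ^ n)
    (continuous_wordDensity v z).aestronglyMeasurable (.of_forall fun y => ?_)
  rw [Real.norm_eq_abs, abs_of_nonneg (wordDensity_nonneg v z y)]
  exact wordDensity_le v z y

theorem emission_eq {σ : ℝ} (hσ : 0 < σ) (z : Word n L) (y : Fin n → ℝ) :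
    emission σ z y = σ ^ n * wordDensity (Real.toNNReal (σ ^ 2)) z y := by
  have h : ∀ m x : ℝ, gaussianPDFReal 0 1 ((m - x) / σ) =
      σ * gaussianPDFReal m (Real.toNNReal (σ ^ 2)) x := by
    intro m x
    simp only [gaussianPDFReal, Real.coe_toNNReal _ (sq_nonneg σ), NNReal.coe_one, mul_one, sub_zero]
    rw [Real.sqrt_mul (by positivity) (σ ^ 2), Real.sqrt_sq hσ.le, mul_inv]
    have e : -((m - x) / σ) ^ 2 / 2 = -(x - m) ^ 2 / (2 * σ ^ 2) := by
      field_simp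
      ring
    rw [e]
    field_simp
  simp [emission, wordDensity, h, Finset.prod_mul_distrib]

/-! ### Linear independence of the Gaussian densities -/

/-- The character `y ↦ exp (∑ₜ zₜ yₜ)`. -/
noncomputable def expChar (z : Word n L) : Multiplicative (Fin n → ℝ) →* ℝ where
  toFun y := Real.exp (∑ t, letterVal (z t) * y.toAdd t)
  map_one' := by simp
  map_mul' a b := by simp [mul_add, Finset.sum_add_distrib, Real.exp_add]

theorem expChar_injective : Function.Injective (expChar : Word n L → _) := by
  intro z z' h
  funext t
  have h1 := DFunLike.congr_fun h (Multiplicative.ofAdd (Pi.single t 1))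
  simp only [expChar, MonoidHom.coe_mk, OneHom.coe_mk, toAdd_ofAdd, Real.exp_eq_exp] at h1
  simp only [Pi.single_apply, mul_ite, mul_one, mul_zero, Finset.sum_ite_eq', Finset.mem_univ,
    if_true, letterVal, add_left_inj, Nat.cast_inj] at h1
  exact Fin.ext h1

/-- Expanding the square at `y = v s` splits the exponent into a part common to all words, a part
free of `s`, and the cross term, which is a character not involving `v`. -/
theorem wordDensity_smul {v : ℝ≥0} (hv : v ≠ 0) (z : Word n L) (s : Fin n → ℝ) :
    wordDensity v z ((v : ℝ) • s) = (∏ t, (√(2 * Real.pi * v))⁻¹ * Real.exp (-v * s t ^ 2 / 2)) *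
      ((∏ t, Real.exp (-letterVal (z t) ^ 2 / (2 * v))) * expChar z (.ofAdd s)) := by
  have hv' : (v : ℝ) ≠ 0 := NNReal.coe_ne_zero.2 hv
  simp only [wordDensity, gaussianPDFReal, expChar, MonoidHom.coe_mk, OneHom.coe_mk, toAdd_ofAdd,
    Real.exp_sum, ← Finset.prod_mul_distrib]
  refine Finset.prod_congr rfl fun t _ => ?_
  rw [← Real.exp_add, mul_assoc _ (Real.exp _) (Real.exp _), ← Real.exp_add]
  congr 2
  simp only [Pi.smul_apply, smul_eq_mul]
  field_simp
  ring

/-- Once the common positive factor is removed, this is Dedekind's independence of distinct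
characters. -/
theorem eq_zero_of_sum_mul_wordDensity_eq_zero {v : ℝ≥0} (hv : v ≠ 0) {w : Word n L → ℝ}
    (h : ∀ y, ∑ z, w z * wordDensity v z y = 0) : w = 0 := by
  have hli : LinearIndependent ℝ fun z : Word n L =>
      (expChar z : Multiplicative (Fin n → ℝ) → ℝ) :=
    (linearIndependent_monoidHom (Multiplicative (Fin n → ℝ)) ℝ).comp expChar expChar_injective
  have hv0 : (0 : ℝ) < v := NNReal.coe_pos.2 (pos_iff_ne_zero.2 hv)
  have hb : ∀ z : Word n L, 0 < ∏ t, Real.exp (-letterVal (z t) ^ 2 / (2 * v)) := fun z =>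
    Finset.prod_pos fun _ _ => Real.exp_pos _
  have hsum : ∑ z : Word n L, (w z * ∏ t, Real.exp (-letterVal (z t) ^ 2 / (2 * v))) •
      (expChar z : Multiplicative (Fin n → ℝ) → ℝ) = 0 := by
    funext s
    have hA : 0 < ∏ t, (√(2 * Real.pi * v))⁻¹ * Real.exp (-v * s.toAdd t ^ 2 / 2) :=
      Finset.prod_pos fun _ _ => by positivity
    refine (mul_eq_zero.1 (Eq.trans ?_ (h ((v : ℝ) • s.toAdd)))).resolve_left hA.ne'
    simp only [wordDensity_smul hv, Finset.sum_apply, Pi.smul_apply, smul_eq_mul, Finset.mul_sum,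
      ofAdd_toAdd]
    exact Finset.sum_congr rfl fun z _ => by ring
  funext z
  exact (mul_eq_zero.1 (Fintype.linearIndependent_iff.1 hli _ hsum z)).resolve_right (hb z).ne'

/-- A combination that is null in `L²` vanishes almost everywhere, hence everywhere by continuity,
so pointwise independence suffices. -/
theorem exists_pos_mul_norm_sq_le_integral_wordDensity {v : ℝ≥0} (hv : v ≠ 0) :
    ∃ c : ℝ, 0 < c ∧ ∀ w : Word n L → ℝ,
      c * ‖w‖ ^ 2 ≤ ∫ y, (∑ z, w z * wordDensity v z y) ^ 2 := by
  refine exists_pos_mul_norm_sq_le_integral_sq _ (integrable_wordDensity_mul v) fun w hw => ?_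
  have hcont : Continuous fun y => (∑ z, w z * wordDensity v z y) ^ 2 :=
    (continuous_finsetSum _ fun z _ => continuous_const.mul (continuous_wordDensity v z)).pow 2
  have hint : Integrable fun y => (∑ z, w z * wordDensity v z y) ^ 2 := by
    simp only [sq, Finset.sum_mul_sum]
    refine integrable_finsetSum _ fun z _ => integrable_finsetSum _ fun z' _ => ?_
    exact ((integrable_wordDensity_mul v z z').const_mul (w z * w z')).congr
      (.of_forall fun y => by simp only []; ring)
  rw [integral_eq_zero_iff_of_nonneg (fun y => sq_nonneg _) hint,
    hcont.ae_eq_iff_eq _ continuous_zero] at hw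
  exact eq_zero_of_sum_mul_wordDensity_eq_zero hv fun y => pow_eq_zero_iff two_ne_zero |>.1
    (congrFun hw y)

/-! ### Laws with density `wordDensity` -/

theorem pi_gaussianReal_eq_withDensity {v : ℝ≥0} (hv : v ≠ 0) (z : Word n L) :
    (Measure.pi fun t => gaussianReal (letterVal (z t)) v) =
      volume.withDensity fun y => ENNReal.ofReal (wordDensity v z y) := by
  refine Measure.pi_eq fun s hs => ?_
  rw [withDensity_apply _ (MeasurableSet.univ_pi hs),
    ← ofReal_integral_eq_lintegral_ofReal (integrable_wordDensity v z).integrableOn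
      (.of_forall fun y => (wordDensity_pos hv z y).le), volume_pi, Measure.restrict_pi_pi]
  unfold wordDensity
  rw [integral_fintype_prod_eq_prod, ENNReal.ofReal_prod_of_nonneg fun t _ =>
    integral_nonneg fun x => gaussianPDFReal_nonneg _ _ _]
  exact Finset.prod_congr rfl fun t _ => (gaussianReal_apply_eq_integral _ hv _).symm

theorem integrable_pi_gaussianReal_iff {v : ℝ≥0} (hv : v ≠ 0) (z : Word n L)
    (f : (Fin n → ℝ) → ℝ) :
    Integrable f (Measure.pi fun t => gaussianReal (letterVal (z t)) v) ↔
      Integrable fun y => wordDensity v z y * f y := by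
  rw [pi_gaussianReal_eq_withDensity hv,
    integrable_withDensity_iff_integrable_smul' (by
      exact (continuous_wordDensity v z).measurable.ennreal_ofReal) (by simp)]
  simp [ENNReal.toReal_ofReal (wordDensity_pos hv z _).le]

theorem integral_pi_gaussianReal {v : ℝ≥0} (hv : v ≠ 0) (z : Word n L)
    (f : (Fin n → ℝ) → ℝ) :
    ∫ y, f y ∂(Measure.pi fun t => gaussianReal (letterVal (z t)) v) =
      ∫ y, wordDensity v z y * f y := by
  rw [pi_gaussianReal_eq_withDensity hv, integral_withDensity_eq_integral_toReal_smul (by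
      exact (continuous_wordDensity v z).measurable.ennreal_ofReal) (by simp)]
  simp [ENNReal.toReal_ofReal (wordDensity_pos hv z _).le]

/-- The log-density is a sum of quadratic polynomials in single coordinates, and Gaussians have
second moments. -/
theorem integrable_log_wordDensity {v : ℝ≥0} (hv : v ≠ 0) (z z' : Word n L) :
    Integrable (fun y => Real.log (wordDensity v z' y))
      (Measure.pi fun t => gaussianReal (letterVal (z t)) v) := by
  unfold wordDensity
  simp only [Real.log_prod fun t _ => (gaussianPDFReal_pos (letterVal (z' t)) v _ hv).ne']
  have hv0 : (0 : ℝ) < v := NNReal.coe_pos.2 (pos_iff_ne_zero.2 hv)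
  have h : ∀ m x, Real.log (gaussianPDFReal m v x) =
      Real.log (√(2 * Real.pi * v))⁻¹ + -(2 * (v : ℝ))⁻¹ * (x - m) ^ 2 := by
    intro m x
    rw [gaussianPDFReal, Real.log_mul (by positivity) (Real.exp_pos _).ne', Real.log_exp]
    ring
  have hi : ∀ t, Integrable (fun x => Real.log (gaussianPDFReal (letterVal (z' t)) v x))
      (gaussianReal (letterVal (z t)) v) := by
    intro t
    simp only [h]
    exact (integrable_const _).add
      (((memLp_id_gaussianReal 2).sub (memLp_const (letterVal (z' t)))).integrable_sq.const_mul _)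
  exact integrable_finsetSum _ fun t _ =>
    integrable_comp_eval (μ := fun t => gaussianReal (letterVal (z t)) v) (hi t)

/-! ### The density of the observations -/

/-- The density of the observations under the parameter `u`. -/
noncomputable def mixDensity (π₀ : Measure (Word n L)) (v : ℝ≥0) (u : Param n L)
    (y : Fin n → ℝ) : ℝ :=
  ∑ z, tiltWeight π₀ u z * wordDensity v z y

theorem continuous_mixDensity {π₀ : Measure (Word n L)} (v : ℝ≥0) (u : Param n L) :
    Continuous (mixDensity π₀ v u) :=
  continuous_finsetSum _ fun z _ => continuous_const.mul (continuous_wordDensity v z)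

section

variable {π₀ : Measure (Word n L)} [IsProbabilityMeasure π₀]

theorem mixDensity_pos (hπ₀ : ∀ z : Word n L, 0 < π₀ {z}) {v : ℝ≥0} (hv : v ≠ 0)
    (u : Param n L) (y : Fin n → ℝ) : 0 < mixDensity π₀ v u y :=
  Finset.sum_pos (fun z _ => mul_pos (tiltWeight_pos hπ₀ u z) (wordDensity_pos hv z y))
    Finset.univ_nonempty

/-- The logarithm is squeezed between that of one weighted component, integrable by
`integrable_log_wordDensity`, and that of the uniform bound. -/
theorem integrable_log_mixDensity (hπ₀ : ∀ z : Word n L, 0 < π₀ {z}) {v : ℝ≥0} (hv : v ≠ 0)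
    (u : Param n L) (z : Word n L) :
    Integrable (fun y => Real.log (mixDensity π₀ v u y))
      (Measure.pi fun t => gaussianReal (letterVal (z t)) v) := by
  have hupper : ∀ y, mixDensity π₀ v u y ≤ (√(2 * Real.pi * v))⁻¹ ^ n := by
    intro y
    calc mixDensity π₀ v u y ≤ ∑ z, tiltWeight π₀ u z * (√(2 * Real.pi * v))⁻¹ ^ n :=
          Finset.sum_le_sum fun z _ =>
            mul_le_mul_of_nonneg_left (wordDensity_le v z y) (tiltWeight_pos hπ₀ u z).le
      _ = _ := by rw [← Finset.sum_mul, sum_tiltWeight hπ₀, one_mul]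
  have hlower : ∀ y, tiltWeight π₀ u z * wordDensity v z y ≤ mixDensity π₀ v u y := fun y =>
    Finset.single_le_sum (f := fun z => tiltWeight π₀ u z * wordDensity v z y)
      (fun z _ => (mul_pos (tiltWeight_pos hπ₀ u z) (wordDensity_pos hv z y)).le)
      (Finset.mem_univ z)
  refine (((integrable_const (Real.log (tiltWeight π₀ u z))).add
    (integrable_log_wordDensity hv z z)).abs.add
    (integrable_const |Real.log ((√(2 * Real.pi * v))⁻¹ ^ n)|)).mono'
    (continuous_mixDensity v u).measurable.log.aestronglyMeasurable (.of_forall fun y => ?_)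
  have hl := Real.log_le_log (mul_pos (tiltWeight_pos hπ₀ u z) (wordDensity_pos hv z y)) (hlower y)
  rw [Real.log_mul (tiltWeight_pos hπ₀ u z).ne' (wordDensity_pos hv z y).ne'] at hl
  exact (abs_le_max_abs_abs hl
    (Real.log_le_log (mixDensity_pos hπ₀ hv u y) (hupper y))).trans
    (max_le_add_of_nonneg (abs_nonneg _) (abs_nonneg _))

/-! ### The negative log-likelihood -/

theorem integral_exp_mul_emission {σ : ℝ} (hσ : 0 < σ) (u : Param n L) (y : Fin n → ℝ) :
    ∫ z, Real.exp (inner ℝ (feature z) u) * emission σ z y ∂π₀ =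
      σ ^ n * ∑ z, π₀.real {z} * Real.exp (inner ℝ (feature z) u) *
        wordDensity (Real.toNNReal (σ ^ 2)) z y := by
  rw [integral_fintype Integrable.of_finite, Finset.mul_sum]
  refine Finset.sum_congr rfl fun z _ => ?_
  rw [emission_eq hσ, smul_eq_mul]
  ring

theorem normalizer_eq {σ : ℝ} (hσ : 0 < σ) (u : Param n L) :
    normalizer Real.exp feature (emission σ) π₀ (volume : Measure (Fin n → ℝ)) u =
      σ ^ n * ∑ z, π₀.real {z} * Real.exp (inner ℝ (feature z) u) := by
  have hv : Real.toNNReal (σ ^ 2) ≠ 0 := (Real.toNNReal_pos.2 (by positivity)).ne'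
  have hem : ∀ z : Word n L, Integrable fun y => Real.exp (inner ℝ (feature z) u) * emission σ z y :=
    fun z => by
      simp only [emission_eq hσ]
      exact ((integrable_wordDensity _ z).const_mul _).const_mul _
  have hmeas : Measurable fun p : Word n L × (Fin n → ℝ) =>
      Real.exp (inner ℝ (feature p.1) u) * emission σ p.1 p.2 := by
    refine measurable_from_prod_countable_right fun z => ?_
    simp only [emission_eq hσ]
    exact ((continuous_wordDensity _ z).measurable.const_mul _).const_mul _
  rw [normalizer, integral_prod _
    ((integrable_prod_iff hmeas.aestronglyMeasurable).2 ⟨.of_forall hem, Integrable.of_finite⟩),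
    integral_fintype Integrable.of_finite, Finset.mul_sum]
  refine Finset.sum_congr rfl fun z _ => ?_
  simp only [emission_eq hσ, integral_const_mul, integral_wordDensity hv, smul_eq_mul]
  ring

/-- The factor `σ ^ n` and the discrete partition sum occur both in the integral over words and in
the normalizer, so they cancel in each summand. -/
theorem hmmNegLogLik_eq (hπ₀ : ∀ z : Word n L, 0 < π₀ {z}) {σ : ℝ} (hσ : 0 < σ) {N : ℕ}
    (u : Param n L) (y : Fin N → Fin n → ℝ) :
    hmmNegLogLik π₀ σ u y =
      ∑ i, -Real.log (mixDensity π₀ (Real.toNNReal (σ ^ 2)) u (y i)) := by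
  have hv : Real.toNNReal (σ ^ 2) ≠ 0 := (Real.toNNReal_pos.2 (by positivity)).ne'
  rw [hmmNegLogLik, negLogLik, ← Finset.sum_neg_distrib, ← Finset.sum_add_distrib]
  refine Finset.sum_congr rfl fun i _ => ?_
  have hW := sum_measureReal_mul_exp_pos hπ₀ u
  have hmix := mixDensity_pos hπ₀ hv u (y i)
  have h : ∑ z, π₀.real {z} * Real.exp (inner ℝ (feature z) u) *
      wordDensity (Real.toNNReal (σ ^ 2)) z (y i) =
      (∑ z, π₀.real {z} * Real.exp (inner ℝ (feature z) u)) *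
        mixDensity π₀ (Real.toNNReal (σ ^ 2)) u (y i) := by
    simp only [mixDensity, tiltWeight]
    rw [Finset.mul_sum]
    refine Finset.sum_congr rfl fun z _ => ?_
    field_simp
  rw [integral_exp_mul_emission hσ, normalizer_eq hσ, h, Real.log_mul (by positivity) (by positivity),
    Real.log_mul hW.ne' hmix.ne', Real.log_mul (by positivity) hW.ne']
  ring

/-! ### Expectations under the joint law -/

theorem integrable_comp_snd_jointLaw {σ : ℝ} (θ : Param n L) {f : (Fin n → ℝ) → ℝ}
    (hfm : Measurable f)
    (hf : ∀ z : Word n L, Integrable f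
      (Measure.pi fun t => gaussianReal (letterVal (z t)) (Real.toNNReal (σ ^ 2)))) :
    Integrable (fun p => f p.2) (jointLaw π₀ σ θ) :=
  (Measure.integrable_compProd_iff (hfm.comp measurable_snd).aestronglyMeasurable).2
    ⟨.of_forall hf, Integrable.of_finite⟩

/-- The observation marginal of the joint law has density `mixDensity`. The integrability half
supplies the hypothesis `hlog` of `mul_norm_sq_le_integral_mul_log`. -/
theorem integral_comp_snd_jointLaw {σ : ℝ} (hσ : 0 < σ) (θ : Param n L) {f : (Fin n → ℝ) → ℝ}
    (hfm : Measurable f)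
    (hf : ∀ z : Word n L, Integrable f
      (Measure.pi fun t => gaussianReal (letterVal (z t)) (Real.toNNReal (σ ^ 2)))) :
    Integrable (fun y => mixDensity π₀ (Real.toNNReal (σ ^ 2)) θ y * f y) ∧
    ∫ p, f p.2 ∂(jointLaw π₀ σ θ) =
      ∫ y, mixDensity π₀ (Real.toNNReal (σ ^ 2)) θ y * f y := by
  have hv : Real.toNNReal (σ ^ 2) ≠ 0 := (Real.toNNReal_pos.2 (by positivity)).ne'
  have hi : ∀ z ∈ (Finset.univ : Finset (Word n L)), Integrable fun y =>
      tiltWeight π₀ θ z * (wordDensity (Real.toNNReal (σ ^ 2)) z y * f y) := fun z _ =>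
    ((integrable_pi_gaussianReal_iff hv z f).1 (hf z)).const_mul _
  simp only [mixDensity, Finset.sum_mul, mul_assoc]
  refine ⟨integrable_finsetSum _ hi, ?_⟩
  rw [integral_finsetSum _ hi, jointLaw,
    Measure.integral_compProd (integrable_comp_snd_jointLaw θ hfm hf),
    integral_fintype Integrable.of_finite]
  refine Finset.sum_congr rfl fun z _ => ?_
  rw [hiddenLaw_real_singleton, integral_const_mul, ← integral_pi_gaussianReal hv]
  rfl

/-- Quadratic lower bound for the expected excess log-loss of a single observation. -/
theorem exists_mul_norm_sub_sq_le_integral_log_mixDensity_sub (hπ₀ : ∀ z : Word n L, 0 < π₀ {z})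
    {σ : ℝ} (hσ : 0 < σ) {D : Set (Param n L)} (hD : Bornology.IsBounded D) :
    ∃ C : ℝ, 0 < C ∧ ∀ u ∈ D, ∀ θ ∈ D, C * ‖u - θ‖ ^ 2 ≤
      ∫ p, (Real.log (mixDensity π₀ (Real.toNNReal (σ ^ 2)) θ p.2) -
        Real.log (mixDensity π₀ (Real.toNNReal (σ ^ 2)) u p.2)) ∂(jointLaw π₀ σ θ) := by
  set v := Real.toNNReal (σ ^ 2) with hvdef
  have hv : v ≠ 0 := (Real.toNNReal_pos.2 (by positivity)).ne'
  have hv0 : (0 : ℝ) < v := NNReal.coe_pos.2 (pos_iff_ne_zero.2 hv)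
  obtain ⟨c₁, hc₁, h₁⟩ := exists_pos_mul_norm_sq_le_integral_wordDensity (n := n) (L := L) hv
  obtain ⟨c₂, hc₂, h₂⟩ := exists_mul_norm_sub_sq_le_norm_tiltWeight_sub hπ₀ hD
  have hK : 0 < (√(2 * Real.pi * v))⁻¹ ^ n := by positivity
  -- `c₁ / (4K)` passes from the divergence to the weights, `c₂` from the weights to the parameter.
  refine ⟨c₁ / (4 * (√(2 * Real.pi * v))⁻¹ ^ n) * c₂, by positivity, fun u hu θ hθ => ?_⟩
  have hm : ∀ u : Param n L, Measurable fun y => Real.log (mixDensity π₀ v u y) := fun u =>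
    (continuous_mixDensity v u).measurable.log
  obtain ⟨hint, heq⟩ := integral_comp_snd_jointLaw (π₀ := π₀) hσ θ ((hm θ).sub (hm u))
    fun z => (integrable_log_mixDensity hπ₀ hv θ z).sub (integrable_log_mixDensity hπ₀ hv u z)
  refine le_trans ?_ ((mul_norm_sq_le_integral_mul_log (wordDensity_pos hv) (wordDensity_le v)
    (integrable_wordDensity v) (integral_wordDensity hv) hK (integrable_wordDensity_mul v) h₁
    (tiltWeight_pos hπ₀ θ) (tiltWeight_pos hπ₀ u) (sum_tiltWeight hπ₀ θ)
    (sum_tiltWeight hπ₀ u) hint).trans heq.ge)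
  rw [mul_assoc]
  gcongr
  exact h₂ u hu θ hθ

end

end HiddenVar

theorem mainTheorem8 {n L N : ℕ} (hN : 0 < N) {σ : ℝ} (hσ : 0 < σ)
    (π₀ : MeasureTheory.Measure (HiddenVar.Word n L)) [IsProbabilityMeasure π₀]
    (hπ₀ : ∀ z : HiddenVar.Word n L, 0 < π₀ {z})
    (D : Set (HiddenVar.Param n L)) (hD : Bornology.IsBounded D)
    (θ : HiddenVar.Param n L) (hθ : θ ∈ D)
    {Ω : Type*} [MeasurableSpace Ω] (P : Measure Ω) [IsProbabilityMeasure P]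
    (ω : Fin N → Ω → HiddenVar.Word n L) (Y : Fin N → Ω → Fin n → ℝ)
    (hlaw : ∀ i, HasLaw (fun s => (ω i s, Y i s)) (HiddenVar.jointLaw π₀ σ θ) P)
    (hindep : iIndepFun (fun i s => (ω i s, Y i s)) P) :
    (∀ u ∈ D, Integrable (fun s => HiddenVar.hmmNegLogLik π₀ σ u (fun i => Y i s)) P) ∧
    ∃ C : ℝ, 0 < C ∧ ∀ u ∈ D,
      C * ‖u - θ‖ ^ 2 ≤
        (∫ s, HiddenVar.hmmNegLogLik π₀ σ u (fun i => Y i s) ∂P) -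
          ∫ s, HiddenVar.hmmNegLogLik π₀ σ θ (fun i => Y i s) ∂P := by
  have hv : Real.toNNReal (σ ^ 2) ≠ 0 := (Real.toNNReal_pos.2 (by positivity)).ne'
  have hm : ∀ u : HiddenVar.Param n L, Measurable fun y =>
      Real.log (HiddenVar.mixDensity π₀ (Real.toNNReal (σ ^ 2)) u y) := fun u =>
    (HiddenVar.continuous_mixDensity _ u).measurable.log
  have hJ : ∀ u, Integrable (fun p : HiddenVar.Word n L × (Fin n → ℝ) =>
      Real.log (HiddenVar.mixDensity π₀ (Real.toNNReal (σ ^ 2)) u p.2))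
      (HiddenVar.jointLaw π₀ σ θ) := fun u =>
    HiddenVar.integrable_comp_snd_jointLaw θ (hm u)
      (HiddenVar.integrable_log_mixDensity hπ₀ hv u)
  have hP : ∀ u i, Integrable (fun s =>
      Real.log (HiddenVar.mixDensity π₀ (Real.toNNReal (σ ^ 2)) u (Y i s))) P := fun u i =>
    ((hlaw i).map_eq ▸ hJ u).comp_aemeasurable (hlaw i).aemeasurable
  have hE : ∀ u i, ∫ s, Real.log (HiddenVar.mixDensity π₀ (Real.toNNReal (σ ^ 2)) u (Y i s)) ∂P =
      ∫ p, Real.log (HiddenVar.mixDensity π₀ (Real.toNNReal (σ ^ 2)) u p.2)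
        ∂(HiddenVar.jointLaw π₀ σ θ) := fun u i =>
    (hlaw i).integral_comp (hJ u).aestronglyMeasurable
  simp only [HiddenVar.hmmNegLogLik_eq hπ₀ hσ]
  refine ⟨fun u _ => integrable_finsetSum _ fun i _ => (hP u i).neg, ?_⟩
  obtain ⟨C, hC, h⟩ :=
    HiddenVar.exists_mul_norm_sub_sq_le_integral_log_mixDensity_sub hπ₀ hσ hD
  refine ⟨C, hC, fun u hu => ?_⟩
  have hu := h u hu θ hθ
  rw [integral_sub (hJ θ) (hJ u)] at hu
  simp only [Finset.sum_neg_distrib, integral_neg]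
  rw [integral_finsetSum _ fun i _ => hP u i, integral_finsetSum _ fun i _ => hP θ i]
  simp only [hE, Finset.sum_const, Finset.card_univ, Fintype.card_fin, nsmul_eq_mul]
  -- The excess is `N` times that of one observation; since `N ≥ 1`, the one-observation constant
  -- still works.
  have hN' : (1 : ℝ) ≤ N := by exact_mod_cast hN
  have hnn : 0 ≤ C * ‖u - θ‖ ^ 2 := by positivity
  nlinarith
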